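/- Let $N\ge 1$, let $E_1\le\dots\le E_N$ be real numbers with $\sum_i E_i=0$, put $A=-i\,\mathrm{diag}(E_1,\dots,E_N)\in\mathfrak{su}(N)$, and let $B=(b_{ij})\in\mathfrak{su}(N)$ (a traceless skew-Hermitian complex $N\times N$ matrix). Index the roots $\alpha_{ij}$ by the pairs $(i,j)$ with $i\ne j$; the value of $\alpha_{ij}$ is $E_j-E_i$, and $\alpha_{ij}$ is positive if $i<j$. Call a root regular for $A$ if its value is nonzero and differs from the value of every other root. Let $\Gamma^+=\{(i,j): i<j,\ b_{ij}\neq 0\}$ be the set of positive roots occurring in $B$, let $\Theta^+\subseteq\Gamma^+$ be the subset of those that are regular for $A$, and let $\Omega^+=\Gamma^+\setminus\Theta^+$ be the subset of the degenerate ones. With $E_{ij}$ the matrix units, $X_{ij}=E_{ij}-E_{ji}$, $Y_{ij}=i(E_{ij}+E_{ji})$ and $B_0$ the diagonal part of $B$, split $B=B_r+B_s$, where $$B_r=B_0+\sum_{(i,j)\in\Theta^+}\bigl(\mathrm{Re}(b_{ij})X_{ij}+\mathrm{Im}(b_{ij})Y_{ij}\bigr),\qquad B_s=\sum_{(i,j)\in\Omega^+}\bigl(\mathrm{Re}(b_{ij})X_{ij}+\mathrm{Im}(b_{ij})Y_{ij}\bigr).$$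 The graph $\mathcal G_M$ of an $N\times N$ matrix $M=(m_{ij})$ has nodes $1,\dots,N$ and arcs $(i,j)$ for $m_{ij}\ne 0$. If $\mathcal G_B$ is connected and $\mathcal G_{B_r}$ is connected, then the system $$\dot X(t)=(A+u(t)B)\,X(t),\qquad X(0)=I,\qquad X(t)\in SU(N),$$ is controllable: for every $\bar X\in SU(N)$ there are $T\ge 0$ and a piecewise constant control $u:[0,T]\to\mathbb R$ such that the solution satisfies $X(T)=\bar X$. -/

import Mathlib

namespace QuantumControl

open Matrix

/-- The skew-Hermitian basis matrix `X_ij = E_ij - E_ji`. -/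
noncomputable def basisX {N : ℕ} (i j : Fin N) : Matrix (Fin N) (Fin N) ℂ :=
  Matrix.single i j 1 - Matrix.single j i 1

/-- The skew-Hermitian basis matrix `Y_ij = i (E_ij + E_ji)`. -/
noncomputable def basisY {N : ℕ} (i j : Fin N) : Matrix (Fin N) (Fin N) ℂ :=
  Complex.I • (Matrix.single i j 1 + Matrix.single j i 1)

/-- The free vector field `A = -i diag(E_1, ..., E_N)` with energy levels `E`. -/
noncomputable def drift {N : ℕ} (E : Fin N → ℝ) : Matrix (Fin N) (Fin N) ℂ :=
  (-Complex.I) • Matrix.diagonal (fun i => (E i : ℂ))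

/-- The value `E_j - E_i` of the root `α_ij` at the free Hamiltonian. The roots are indexed by the
pairs `(i, j)` with `i ≠ j`, the positive roots by the pairs with `i < j`. -/
def rootValue {N : ℕ} (E : Fin N → ℝ) (p : Fin N × Fin N) : ℝ :=
  E p.2 - E p.1

/-- The root indexed by `p` is regular for `A = drift E`: its value is nonzero and differs from the
value of every other root. -/
def IsRegularRoot {N : ℕ} (E : Fin N → ℝ) (p : Fin N × Fin N) : Prop :=
  rootValue E p ≠ 0 ∧
    ∀ q : Fin N × Fin N, q.1 ≠ q.2 → q ≠ p → rootValue E q ≠ rootValue E p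

open Classical in
/-- `Γ⁺`: the positive roots occurring in `B`. -/
noncomputable def positiveRoots {N : ℕ} (B : Matrix (Fin N) (Fin N) ℂ) :
    Finset (Fin N × Fin N) :=
  {p : Fin N × Fin N | p.1 < p.2 ∧ B p.1 p.2 ≠ 0}

open Classical in
/-- `Θ⁺`: the positive roots occurring in `B` that are regular for `A`. -/
noncomputable def regularRoots {N : ℕ} (E : Fin N → ℝ) (B : Matrix (Fin N) (Fin N) ℂ) :
    Finset (Fin N × Fin N) :=
  {p ∈ positiveRoots B | IsRegularRoot E p}

open Classical in
/-- `Ω⁺ = Γ⁺ \ Θ⁺`: the positive roots occurring in `B` that are degenerate for `A`. -/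
noncomputable def degenerateRoots {N : ℕ} (E : Fin N → ℝ) (B : Matrix (Fin N) (Fin N) ℂ) :
    Finset (Fin N × Fin N) :=
  positiveRoots B \ regularRoots E B

/-- The component `b^Re X_ij + b^Im Y_ij` of `B` along the root indexed by `p = (i, j)`. -/
noncomputable def rootComponent {N : ℕ} (B : Matrix (Fin N) (Fin N) ℂ) (p : Fin N × Fin N) :
    Matrix (Fin N) (Fin N) ℂ :=
  (B p.1 p.2).re • basisX p.1 p.2 + (B p.1 p.2).im • basisY p.1 p.2

/-- `B_r`: the diagonal part `B_0` of `B` together with its components along the regular roots. -/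
noncomputable def regularPart {N : ℕ} (E : Fin N → ℝ) (B : Matrix (Fin N) (Fin N) ℂ) :
    Matrix (Fin N) (Fin N) ℂ :=
  Matrix.diagonal B.diag + ∑ p ∈ regularRoots E B, rootComponent B p

/-- `B_s`: the components of `B` along the degenerate roots. -/
noncomputable def degeneratePart {N : ℕ} (E : Fin N → ℝ) (B : Matrix (Fin N) (Fin N) ℂ) :
    Matrix (Fin N) (Fin N) ℂ :=
  ∑ p ∈ degenerateRoots E B, rootComponent B p

/-- The oriented graph of a square matrix: the arcs are the pairs `(i, j)` with `M i j ≠ 0`. -/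
def matrixGraph {N : ℕ} (M : Matrix (Fin N) (Fin N) ℂ) : Digraph (Fin N) where
  Adj i j := M i j ≠ 0

/-- The graph of `M` is connected: any two nodes are joined by a path of arcs, traversed in either
direction. For the skew-Hermitian matrices considered here this is strong connectedness. -/
def GraphConnected {N : ℕ} (M : Matrix (Fin N) (Fin N) ℂ) : Prop :=
  (matrixGraph M).toSimpleGraphInclusive.Connected

/-- `u` is piecewise constant on `[0, T]`: off a finite set it is locally constant. -/
def PiecewiseConstant (u : ℝ → ℝ) (T : ℝ) : Prop :=
  ∃ S : Finset ℝ, ∀ t ∈ Set.Ioo 0 T, t ∉ S → ∀ᶠ s in nhds t, u s = u t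

/-- `X` is an integral curve on `[0, T]`, starting from the identity, of the control system
`X' = (A + u B) X` on `SU(N)`: it is continuous and satisfies the equation off a finite set of
times. -/
def IsIntegralCurve {N : ℕ} (A B : Matrix (Fin N) (Fin N) ℂ) (u : ℝ → ℝ) (T : ℝ)
    (X : ℝ → Matrix.specialUnitaryGroup (Fin N) ℂ) : Prop :=
  X 0 = 1 ∧ ContinuousOn X (Set.Icc 0 T) ∧
    ∃ S : Finset ℝ, ∀ t ∈ Set.Ioo 0 T, t ∉ S →
      HasDerivAt (fun s => (X s : Matrix (Fin N) (Fin N) ℂ))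
        ((A + u t • B) * (X t : Matrix (Fin N) (Fin N) ℂ)) t

/-- The set of elements of `SU(N)` that can be reached from the identity in some time `T ≥ 0` by
a piecewise constant control. -/
def reachableSet {N : ℕ} (A B : Matrix (Fin N) (Fin N) ℂ) :
    Set (Matrix.specialUnitaryGroup (Fin N) ℂ) :=
  {Z | ∃ T : ℝ, 0 ≤ T ∧ ∃ u : ℝ → ℝ, PiecewiseConstant u T ∧
    ∃ X : ℝ → Matrix.specialUnitaryGroup (Fin N) ℂ, IsIntegralCurve A B u T X ∧ X T = Z}

/-- The control system `X' = (A + u B) X`, `X(0) = I`, on `SU(N)` is controllable. -/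
def Controllable {N : ℕ} (A B : Matrix (Fin N) (Fin N) ℂ) : Prop :=
  reachableSet A B = Set.univ

/-- A skew-Hermitian matrix is the sum of its regular and its degenerate part. -/
theorem regularPart_add_degeneratePart {N : ℕ} (E : Fin N → ℝ) (B : Matrix (Fin N) (Fin N) ℂ)
    (hB : Bᴴ = -B) : B = regularPart E B + degeneratePart E B := by
  classical
  have hsub : regularRoots E B ⊆ positiveRoots B := by
    unfold regularRoots
    exact Finset.filter_subset _ _
  have hsum : regularPart E B + degeneratePart E B
      = Matrix.diagonal B.diag + ∑ p ∈ positiveRoots B, rootComponent B p := by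
    unfold regularPart degeneratePart degenerateRoots
    rw [add_assoc, ← Finset.sum_sdiff hsub]
    congr 1
    rw [add_comm]
  have hc : ∀ i j, B j i = -(starRingEnd ℂ) (B i j) := by
    intro i j
    have h := congrFun (congrFun hB j) i
    simp only [Matrix.conjTranspose_apply, Matrix.neg_apply] at h
    rw [starRingEnd_apply, h, neg_neg]
  have hcomp : ∀ p : Fin N × Fin N, rootComponent B p
      = Matrix.single p.1 p.2 (B p.1 p.2) + Matrix.single p.2 p.1 (B p.2 p.1) := by
    intro p
    ext k l
    rw [hc p.1 p.2]
    simp only [rootComponent, basisX, basisY, Matrix.add_apply, Matrix.smul_apply,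
      Matrix.sub_apply, Matrix.single_apply]
    split_ifs <;> apply Complex.ext <;> (simp; try ring)
  have hlt : ∑ p ∈ positiveRoots B, rootComponent B p
      = ∑ p : Fin N × Fin N, if p.1 < p.2 then rootComponent B p else 0 := by
    unfold positiveRoots
    rw [Finset.sum_filter]
    refine Finset.sum_congr rfl fun p _ => ?_
    by_cases h0 : B p.1 p.2 = 0
    · simp [h0, rootComponent]
    · simp [h0]
  rw [hsum, hlt, Fintype.sum_prod_type]
  ext k l
  have h1 : (∑ i : Fin N, ∑ j : Fin N,
      (if i < j then rootComponent B (i, j) else 0 : Matrix (Fin N) (Fin N) ℂ)) k l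
      = (if k < l then B k l else 0) + (if l < k then B k l else 0) := by
    have h2 : ∀ i j : Fin N,
        (if i < j then rootComponent B (i, j) else 0 : Matrix (Fin N) (Fin N) ℂ) k l
        = (if i = k then if j = l then if k < l then B k l else 0 else 0 else 0)
          + (if i = l then if j = k then if l < k then B k l else 0 else 0 else 0) := by
      intro i j
      rw [hcomp]
      clear hc hcomp hsum hlt hsub hB
      by_cases hij : i < j
      · simp only [hij, if_true, Matrix.add_apply, Matrix.single_apply]
        congr 1 <;> split_ifs <;> simp_all
      · simp only [hij, if_false, Matrix.zero_apply]
        split_ifs <;> simp_all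
    simp only [Matrix.sum_apply, h2, Finset.sum_add_distrib]
    simp
  rw [Matrix.add_apply, h1]
  rcases lt_trichotomy k l with h | h | h
  · simp [h, h.ne, h.not_gt]
  · simp [h]
  · simp [h, h.ne', h.not_gt]

end QuantumControl

/-!
Writing `A` for the drift, the bracket with `A` multiplies the `(k, l)` entry of a matrix by `i`
times the value of the root `(k, l)`. Applied to `B`, a real polynomial in `-(ad A) ^ 2` therefore
multiplies the entries by a polynomial in the squared root values, and Lagrange interpolation
isolates the component of `B` along any regular root. One more bracket with `A` rotates this
component inside its root plane, so the Lie algebra generated by `A` and `B` contains the whole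
plane. Brackets of root planes follow paths in the graph of `B_r`, whose connectedness produces
every root plane and then all of `𝔰𝔲(N)`.

The reachable set is a submonoid `S` of `SU(N)` containing `exp (t (A + c B))` for `t ≥ 0`. Only
nonnegative times are available, so the conjugates `g C g⁻¹` with `g ∈ S` and `C = A + c B` take
the place of brackets: their span is invariant under conjugation by `exp (t C)` and, on
differentiating, under `ad C`, hence contains `𝔰𝔲(N)`. Inserting factors `exp (r C)` one at a time,
each adding a new direction, gives a smooth map into `S` whose differential has all of
`𝔰𝔲(N)` in its range, so `S` has an interior point. In a compact group a submonoid is dense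
in the subgroup it generates; this subgroup is open, hence everything as `SU(N)` is connected, and
a dense submonoid with an interior point is the whole group.
-/

namespace QuantumControl

open Matrix

attribute [local instance] LieRing.ofAssociativeRing

theorem lieSpan_toSubmodule_le {R L : Type*} [CommRing R] [LieRing L] [LieAlgebra R L]
    {s : Set L} {V : Submodule R L} (hsV : s ⊆ V) (hlie : ∀ x ∈ s, ∀ y ∈ V, ⁅x, y⁆ ∈ V) :
    (LieSubalgebra.lieSpan R L s).toSubmodule ≤ V := by
  suffices h : ∀ x ∈ LieSubalgebra.lieSpan R L s, x ∈ V ∧ ∀ y ∈ V, ⁅x, y⁆ ∈ V from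
    fun x hx => (h x hx).1
  intro x hx
  induction hx using LieSubalgebra.lieSpan_induction with
  | mem x hx => exact ⟨hsV hx, hlie x hx⟩
  | zero => exact ⟨V.zero_mem, fun y _ => by rw [zero_lie]; exact V.zero_mem⟩
  | add x y _ _ hx hy =>
    exact ⟨V.add_mem hx.1 hy.1, fun z hz => by
      rw [add_lie]; exact V.add_mem (hx.2 z hz) (hy.2 z hz)⟩
  | smul r x _ hx =>
    exact ⟨V.smul_mem r hx.1, fun z hz => by rw [smul_lie]; exact V.smul_mem r (hx.2 z hz)⟩
  | lie x y _ _ hx hy =>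
    exact ⟨hx.2 y hy.1, fun z hz => by
      rw [lie_lie]; exact V.sub_mem (hx.2 _ (hy.2 z hz)) (hy.2 _ (hx.2 z hz))⟩

section SkewSingle

variable {n : Type*} [DecidableEq n]

/-- The skew-Hermitian matrix with entries `z` at `(i, j)` and `-z̄` at `(j, i)`, as a real-linear
function of `z`; for `i = j` its only entry is `z - z̄`. -/
noncomputable def skewSingle (i j : n) : ℂ →ₗ[ℝ] Matrix n n ℂ where
  toFun z := single i j z - (single i j z)ᴴ
  map_add' z w := by rw [single_add, conjTranspose_add, add_sub_add_comm]
  map_smul' r z := by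
    rw [← smul_single, conjTranspose_smul, star_trivial, smul_sub, RingHom.id_apply]

theorem skewSingle_apply (i j : n) (z : ℂ) :
    skewSingle i j z = single i j z - single j i (star z) := by
  rw [← conjTranspose_single]
  rfl

theorem skewSingle_swap (i j : n) (z : ℂ) : skewSingle j i z = skewSingle i j (-star z) := by
  simp only [skewSingle_apply, star_neg, star_star, ← Matrix.single_neg]
  abel

variable [Fintype n]

theorem lie_skewSingle {i j k : n} (hij : i ≠ j) (hjk : j ≠ k) (hik : i ≠ k) (z w : ℂ) :
    ⁅skewSingle i j z, skewSingle j k w⁆ = skewSingle i k (z * w) := by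
  simp only [skewSingle_apply, Ring.lie_def, sub_mul, mul_sub, star_mul', mul_comm z w,
    single_mul_single_same, ne_eq, hij, hij.symm, hjk, hjk.symm, hik, hik.symm, not_false_eq_true,
    single_mul_single_of_ne]
  rw [mul_comm (star w)]
  abel

theorem lie_skewSingle_swap {i j : n} (hij : i ≠ j) (z w : ℂ) :
    ⁅skewSingle i j z, skewSingle j i w⁆ = skewSingle i i (z * w) - skewSingle j j (z * w) := by
  simp only [skewSingle_apply, Ring.lie_def, sub_mul, mul_sub, star_mul',
    single_mul_single_same, ne_eq, hij, hij.symm, not_false_eq_true,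
    single_mul_single_of_ne]
  rw [mul_comm z w, mul_comm (star w)]
  abel

theorem sum_skewSingle {M : Matrix n n ℂ} (hM : Mᴴ = -M) :
    ∑ i, ∑ j, skewSingle i j (M i j) = (2 : ℝ) • M := by
  have h : ∑ i, ∑ j, skewSingle i j (M i j) = M - Mᴴ := by
    conv_rhs => rw [matrix_eq_sum_single M]
    simp only [conjTranspose_sum, ← Finset.sum_sub_distrib]
    rfl
  rw [h, hM, sub_neg_eq_add, two_smul]

theorem skewSingle_mem_of_preconnected {L : LieSubalgebra ℝ (Matrix n n ℂ)} {G : SimpleGraph n}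
    (hG : G.Preconnected) (hL : ∀ i j, G.Adj i j → ∀ z, skewSingle i j z ∈ L) {i j : n}
    (hij : i ≠ j) (z : ℂ) : skewSingle i j z ∈ L := by
  obtain ⟨walk⟩ := hG i j
  induction walk generalizing z with
  | nil => exact absurd rfl hij
  | @cons i k j hik _ ih =>
    by_cases hkj : k = j
    · exact hkj ▸ hL i k hik z
    · rw [← one_mul z, ← lie_skewSingle hik.ne hkj hij]
      exact L.lie_mem (hL i k hik 1) (ih hkj z)

variable (n) in
/-- The real Lie algebra `𝔰𝔲(n)` of traceless skew-Hermitian complex matrices. -/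
def su : LieSubalgebra ℝ (Matrix n n ℂ) where
  carrier := {X | Xᴴ = -X ∧ X.trace = 0}
  add_mem' := fun {X Y} hX hY => by
    refine ⟨?_, ?_⟩
    · rw [conjTranspose_add, hX.1, hY.1, neg_add]
    · rw [trace_add, hX.2, hY.2, add_zero]
  zero_mem' := ⟨by simp, trace_zero n ℂ⟩
  smul_mem' := fun r X hX => by
    refine ⟨?_, ?_⟩
    · rw [conjTranspose_smul, hX.1, smul_neg, star_trivial]
    · rw [trace_smul, hX.2, smul_zero]
  lie_mem' := fun {X Y} hX hY => by
    refine ⟨?_, ?_⟩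
    · rw [Ring.lie_def, conjTranspose_sub, conjTranspose_mul, conjTranspose_mul, hX.1, hY.1,
        neg_mul_neg, neg_mul_neg, neg_sub]
    · rw [Ring.lie_def, trace_sub, trace_mul_comm, sub_self]

theorem mem_su {X : Matrix n n ℂ} : X ∈ su n ↔ Xᴴ = -X ∧ X.trace = 0 := Iff.rfl

theorem su_le_of_skewSingle_mem {L : LieSubalgebra ℝ (Matrix n n ℂ)}
    (hL : ∀ i j, i ≠ j → ∀ z, skewSingle i j z ∈ L) : su n ≤ L := by
  intro M hM
  rw [mem_su] at hM
  rcases isEmpty_or_nonempty n with hn | ⟨⟨o⟩⟩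
  · rw [Subsingleton.elim M 0]
    exact L.zero_mem
  have hdiag_sub : ∀ i z, skewSingle i i z - skewSingle o o z ∈ L := fun i z => by
    by_cases hio : i = o
    · rw [hio, sub_self]
      exact L.zero_mem
    · rw [← one_mul z, ← lie_skewSingle_swap hio]
      exact L.lie_mem (hL i o hio 1) (hL o i (Ne.symm hio) z)
  have htrace : ∑ i, skewSingle o o (M i i) = 0 := by
    rw [← map_sum, ← map_zero (skewSingle o o), ← hM.2]
    rfl
  have hsum : (2 : ℝ) • M = ∑ i, (∑ j, skewSingle i j (M i j) - skewSingle o o (M i i)) := by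
    rw [Finset.sum_sub_distrib, htrace, sub_zero, sum_skewSingle hM.1]
  have htwo : (2 : ℝ) • M ∈ L := by
    rw [hsum]
    refine sum_mem fun i _ => ?_
    rw [← Finset.add_sum_erase _ _ (Finset.mem_univ i), add_sub_right_comm]
    exact add_mem (hdiag_sub i _)
      (sum_mem fun j hj => hL i j (Finset.ne_of_mem_erase hj).symm _)
  simpa using L.smul_mem (2⁻¹ : ℝ) htwo

end SkewSingle

section Exponential

open Topology NormedSpace

variable {𝔸 : Type*} [NormedRing 𝔸] [NormedAlgebra ℝ 𝔸] [CompleteSpace 𝔸]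

theorem eventually_exp_eq_iff :
    ∀ᶠ p in 𝓝 (0 : 𝔸 × 𝔸), exp p.1 = exp p.2 ↔ p.1 = p.2 := by
  have hexp : HasStrictFDerivAt exp (ContinuousLinearEquiv.refl ℝ 𝔸 : 𝔸 →L[ℝ] 𝔸) 0 :=
    hasStrictFDerivAt_exp_zero
  filter_upwards [hexp.eventually_left_inverse.prod_nhds hexp.eventually_left_inverse] with p hp
  exact ⟨fun h => by rw [← hp.1, ← hp.2, h], congrArg exp⟩

theorem lie_mem_of_exp_conj_mem {V : Submodule ℝ 𝔸} (hV : IsClosed (V : Set 𝔸)) {C X : 𝔸}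
    (h : ∀ t : ℝ, 0 ≤ t → exp (t • C) * X * exp (t • -C) ∈ V) : ⁅C, X⁆ ∈ V := by
  have hderiv : HasDerivAt (fun t : ℝ => exp (t • C) * X * exp (t • -C)) ⁅C, X⁆ 0 :=
    (((hasDerivAt_exp_smul_const C (0 : ℝ)).mul_const X).mul
      (hasDerivAt_exp_smul_const (-C) (0 : ℝ))).congr_deriv (by simp [Ring.lie_def, sub_eq_add_neg])
  refine hV.mem_of_tendsto hderiv.tendsto_slope_zero_right ?_
  filter_upwards [self_mem_nhdsWithin] with t ht
  exact V.smul_mem _ (V.sub_mem (h _ (by simpa using ht.le)) (h 0 le_rfl))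

theorem exists_log_of_eventually_mem {G : Set 𝔸} {𝔤 : Submodule ℝ 𝔸} [FiniteDimensional ℝ 𝔤]
    (h𝔤 : ∀ᶠ X in 𝓝 (0 : 𝔸), exp X ∈ G → X ∈ 𝔤) :
    ∃ (log : 𝔸 → 𝔤) (π : 𝔸 →L[ℝ] 𝔤), HasStrictFDerivAt log π 1 ∧ log 1 = 0 ∧
      (∀ X : 𝔤, π X = X) ∧ ∀ᶠ Z in 𝓝[G] (1 : 𝔸), exp (log Z : 𝔸) = Z := by
  have hexp : HasStrictFDerivAt exp (ContinuousLinearEquiv.refl ℝ 𝔸 : 𝔸 →L[ℝ] 𝔸) 0 :=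
    hasStrictFDerivAt_exp_zero
  let ℓ := hexp.localInverse
  have hℓ : HasStrictFDerivAt ℓ (ContinuousLinearMap.id ℝ 𝔸) (1 : 𝔸) := by
    simpa using hexp.to_localInverse
  have hℓ_one : ℓ 1 = 0 := by
    simpa using hexp.localInverse_apply_image
  have hexp_ℓ : ∀ᶠ Z in 𝓝 (1 : 𝔸), exp (ℓ Z) = Z := by
    simpa using hexp.eventually_right_inverse
  have hℓ_mem : ∀ᶠ Z in 𝓝 (1 : 𝔸), exp (ℓ Z) ∈ G → ℓ Z ∈ 𝔤 :=
    hℓ.continuousAt.eventually (p := fun X => exp X ∈ G → X ∈ 𝔤) (hℓ_one.symm ▸ h𝔤)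
  obtain ⟨π, hπ⟩ := Submodule.ClosedComplemented.of_finiteDimensional 𝔤
  refine ⟨fun Z => π (ℓ Z), π, π.hasStrictFDerivAt.comp 1 hℓ, by simp [hℓ_one], hπ, ?_⟩
  filter_upwards [nhdsWithin_le_nhds hℓ_mem, nhdsWithin_le_nhds hexp_ℓ, self_mem_nhdsWithin]
    with Z hmem hinv hZ
  rw [hπ ⟨ℓ Z, hmem (hinv.symm ▸ hZ)⟩, hinv]

theorem nhdsWithin_one_le_map {V : Type*} [NormedAddCommGroup V] [NormedSpace ℝ V]
    [CompleteSpace V] {G : Set 𝔸} {𝔤 : Submodule ℝ 𝔸} [FiniteDimensional ℝ 𝔤]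
    (h𝔤 : ∀ᶠ X in 𝓝 (0 : 𝔸), exp X ∈ G → X ∈ 𝔤) {F : V → 𝔸} {F' : V →L[ℝ] 𝔸}
    (hF : HasStrictFDerivAt F F' 0) (hF_zero : F 0 = 1) (hFG : ∀ᶠ v in 𝓝 0, F v ∈ G)
    (hrange : 𝔤 ≤ F'.range) : 𝓝[G] 1 ≤ Filter.map F (𝓝 0) := by
  obtain ⟨log, π, hlog, hlog_one, hπ, hexp_log⟩ := exists_log_of_eventually_mem h𝔤
  have hF_tendsto : Filter.Tendsto F (𝓝 0) (𝓝[G] 1) :=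
    tendsto_nhdsWithin_iff.2 ⟨hF_zero ▸ hF.continuousAt, hFG⟩
  have hlog_tendsto : Filter.Tendsto log (𝓝[G] 1) (𝓝 0) :=
    (hlog_one ▸ hlog.continuousAt.tendsto).mono_left nhdsWithin_le_nhds
  have hmap : Filter.map (log ∘ F) (𝓝 0) = 𝓝 0 := by
    have hsurj : (π ∘L F').range = ⊤ := LinearMap.range_eq_top.2 fun X => by
      obtain ⟨v, hv⟩ := hrange X.2
      exact ⟨v, (congrArg π hv).trans (hπ X)⟩
    have hopen := ((hF_zero ▸ hlog).comp 0 hF).map_nhds_eq_of_surj hsurj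
    rwa [hF_zero, hlog_one] at hopen
  calc 𝓝[G] 1 = Filter.map ((fun X : 𝔤 => exp (X : 𝔸)) ∘ log) (𝓝[G] 1) :=
        ((Filter.map_congr hexp_log).trans Filter.map_id').symm
    _ ≤ Filter.map (fun X : 𝔤 => exp (X : 𝔸)) (𝓝 0) := by
        rw [← Filter.map_map]
        exact Filter.map_mono hlog_tendsto
    _ = Filter.map F (𝓝 0) := by
        rw [← hmap, Filter.map_map]
        exact Filter.map_congr (hF_tendsto.eventually hexp_log)

end Exponential

section Orbit

open Topology NormedSpace

variable {𝔸 : Type*} [NormedRing 𝔸] [NormedAlgebra ℝ 𝔸]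

/-- The span of the conjugates `g C g⁻¹` of the elements `C` of `D` by the units `g` in `S`. -/
noncomputable def conjSpan (S : Submonoid 𝔸) (D : Set 𝔸) : Submodule ℝ 𝔸 :=
  Submodule.span ℝ {X | ∃ g : 𝔸ˣ, (g : 𝔸) ∈ S ∧ ∃ C ∈ D, X = g * C * (g⁻¹ : 𝔸ˣ)}

/-- `R` is the image of the differential at `0` of a map `F` with `F 0 = 1` such that `F v * g`
belongs to `S` for small `v`: a space of directions, translated back to the identity, in which `S`
extends around its point `g`. -/
def IsTangentSpaceAt (S : Submonoid 𝔸) (g : 𝔸ˣ) (R : Submodule ℝ 𝔸) : Prop :=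
  ∃ (V : Type) (_ : NormedAddCommGroup V) (_ : NormedSpace ℝ V) (_ : CompleteSpace V)
    (F : V → 𝔸) (F' : V →L[ℝ] 𝔸), HasStrictFDerivAt F F' 0 ∧ F 0 = 1 ∧
      (∀ᶠ v in 𝓝 0, F v * g ∈ S) ∧ F'.range = R

variable {S : Submonoid 𝔸} {D : Set 𝔸} {g h : 𝔸ˣ} {R : Submodule ℝ 𝔸} {C : 𝔸}

theorem conj_mem_conjSpan (hg : (g : 𝔸) ∈ S) (hC : C ∈ D) :
    g * C * (g⁻¹ : 𝔸ˣ) ∈ conjSpan S D :=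
  Submodule.subset_span ⟨g, hg, C, hC, rfl⟩

theorem conj_mem_conjSpan_of_mem {X : 𝔸} (hg : (g : 𝔸) ∈ S) (hX : X ∈ conjSpan S D) :
    g * X * (g⁻¹ : 𝔸ˣ) ∈ conjSpan S D := by
  induction hX using Submodule.span_induction with
  | mem X hX =>
    obtain ⟨h, hh, C, hC, rfl⟩ := hX
    simpa [mul_assoc] using
      conj_mem_conjSpan (g := g * h) (by simpa using S.mul_mem hg hh) hC
  | zero => simp
  | add X Y _ _ hX hY => simpa [mul_add, add_mul] using Submodule.add_mem _ hX hY
  | smul r X _ hX => simpa using Submodule.smul_mem _ r hX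

theorem isTangentSpaceAt_one (S : Submonoid 𝔸) : IsTangentSpaceAt S 1 ⊥ :=
  ⟨Unit, inferInstance, inferInstance, inferInstance, fun _ => 1, 0,
    hasStrictFDerivAt_const 1 0, rfl, by simp, by simp⟩

theorem IsTangentSpaceAt.mem (hR : IsTangentSpaceAt S g R) : (g : 𝔸) ∈ S := by
  obtain ⟨V, _, _, _, F, F', -, hF_zero, hFS, -⟩ := hR
  simpa [hF_zero] using hFS.self_of_nhds

variable [CompleteSpace 𝔸]

theorem hasStrictFDerivAt_mul_exp_smul {V : Type*} [NormedAddCommGroup V] [NormedSpace ℝ V]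
    {F : V → 𝔸} {F' : V →L[ℝ] 𝔸} (hF : HasStrictFDerivAt F F' 0) (hF_zero : F 0 = 1) (X : 𝔸) :
    HasStrictFDerivAt (fun p : V × ℝ => F p.1 * exp (p.2 • X))
      (F'.coprod (.toSpanSingleton ℝ X)) 0 := by
  have hfst : HasStrictFDerivAt (fun p : V × ℝ => F p.1) (F' ∘L .fst ℝ V ℝ) 0 :=
    hF.comp (0 : V × ℝ) (hasStrictFDerivAt_fst (p := 0))
  have hexp : HasStrictFDerivAt (fun r : ℝ => exp (r • X)) (.toSpanSingleton ℝ X)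
      (0 : V × ℝ).2 := by
    simpa using (hasStrictDerivAt_exp_smul_const X (0 : ℝ)).hasStrictFDerivAt
  refine (hfst.mul' (hexp.comp (0 : V × ℝ) hasStrictFDerivAt_snd)).congr_fderiv ?_
  ext <;> simp [hF_zero]

theorem IsTangentSpaceAt.exists_sup_span (hR : IsTangentSpaceAt S g R) (hh : (h : 𝔸) ∈ S)
    (hC : ∀ t : ℝ, 0 ≤ t → exp (t • C) ∈ S) :
    ∃ g', IsTangentSpaceAt S g'
      (R ⊔ Submodule.span ℝ {((g * h : 𝔸ˣ) : 𝔸) * C * ((g * h)⁻¹ : 𝔸ˣ)}) := by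
  obtain ⟨V, _, _, _, F, F', hF, hF_zero, hFS, rfl⟩ := hR
  have : NormedAlgebra ℚ 𝔸 := .restrictScalars ℚ ℝ _
  obtain ⟨e, he⟩ := isUnit_exp C
  set X := ((g * h : 𝔸ˣ) : 𝔸) * C * ((g * h)⁻¹ : 𝔸ˣ) with hX
  refine ⟨g * h * e, V × ℝ, inferInstance, inferInstance, inferInstance,
    fun p => F p.1 * exp (p.2 • X), F'.coprod (.toSpanSingleton ℝ X),
    hasStrictFDerivAt_mul_exp_smul hF hF_zero X, by simp [hF_zero], ?_, ?_⟩
  · have hpos : ∀ᶠ p : V × ℝ in 𝓝 0, 0 ≤ p.2 + 1 :=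
      ((continuous_snd.add continuous_const).tendsto' _ _ (by simp)).eventually_const_le zero_lt_one
    filter_upwards [(continuous_fst.tendsto' (0 : V × ℝ) 0 rfl).eventually hFS, hpos] with p hp hp₁
    have hfactor : F p.1 * exp (p.2 • X) * (g * h * e : 𝔸ˣ) =
        F p.1 * g * h * exp ((p.2 + 1) • C) := by
      have hsmul : p.2 • X = ((g * h : 𝔸ˣ) : 𝔸) * (p.2 • C) * ((g * h)⁻¹ : 𝔸ˣ) := by
        rw [hX, mul_smul_comm, smul_mul_assoc]
      rw [hsmul, NormedSpace.exp_units_conj, add_smul, one_smul,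
        exp_add_of_commute (Commute.refl C |>.smul_left p.2), ← he]
      simp [mul_assoc]
    rw [hfactor]
    exact S.mul_mem (S.mul_mem hp hh) (hC _ hp₁)
  · rw [ContinuousLinearMap.range_coprod]
    congr 1
    exact LinearMap.range_toSpanSingleton X

theorem exists_isTangentSpaceAt_conj_mem [IsNoetherian ℝ 𝔸]
    (hD : ∀ C ∈ D, ∀ t : ℝ, 0 ≤ t → exp (t • C) ∈ S) :
    ∃ g R, IsTangentSpaceAt S g R ∧ ∀ X ∈ conjSpan S D, g * X * (g⁻¹ : 𝔸ˣ) ∈ R := by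
  obtain ⟨R, ⟨g, hg⟩, hmax⟩ := set_has_maximal_iff_noetherian.2 ‹IsNoetherian ℝ 𝔸›
    {R | ∃ g, IsTangentSpaceAt S g R} ⟨⊥, 1, isTangentSpaceAt_one S⟩
  refine ⟨g, R, hg, fun X hX => ?_⟩
  induction hX using Submodule.span_induction with
  | mem X hX =>
    obtain ⟨h, hh, C, hC, rfl⟩ := hX
    have hle := left_eq_sup.1 (eq_of_le_of_not_lt le_sup_left
      (hmax _ (hg.exists_sup_span hh (hD C hC))))
    simpa [mul_assoc] using hle (Submodule.mem_span_singleton_self _)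
  | zero => simp
  | add X Y _ _ hX hY => simpa [mul_add, add_mul] using R.add_mem hX hY
  | smul r X _ hX => simpa using R.smul_mem r hX

theorem lieSpan_le_conjSpan [FiniteDimensional ℝ 𝔸]
    (hD : ∀ C ∈ D, ∀ t : ℝ, 0 ≤ t → exp (t • C) ∈ S) :
    (LieSubalgebra.lieSpan ℝ 𝔸 D).toSubmodule ≤ conjSpan S D := by
  refine lieSpan_toSubmodule_le
    (fun C hC => by simpa using conj_mem_conjSpan (g := 1) S.one_mem hC)
    fun C hC X hX => ?_
  refine lie_mem_of_exp_conj_mem (Submodule.closed_of_finiteDimensional _) fun t ht => ?_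
  have : NormedAlgebra ℚ 𝔸 := .restrictScalars ℚ ℝ _
  obtain ⟨e, he⟩ := isUnit_exp (t • C)
  have he_inv : ((e⁻¹ : 𝔸ˣ) : 𝔸) = exp (t • -C) := by
    rw [smul_neg, ← Ring.inverse_exp, ← he, Ring.inverse_unit]
  rw [← he_inv, ← he]
  exact conj_mem_conjSpan_of_mem (he ▸ hD C hC t ht) hX

end Orbit

section TopologicalGroup

open Topology

theorem submonoid_eq_top_of_mem_nhds {G : Type*} [Group G] [TopologicalSpace G]
    [IsTopologicalGroup G] [CompactSpace G] [PreconnectedSpace G] {S : Submonoid G} {g : G}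
    (hS : (S : Set G) ∈ 𝓝 g) : S = ⊤ := by
  have hclosure : Subgroup.closure (S : Set G) = ⊤ := by
    have hopen : IsOpen (Subgroup.closure (S : Set G) : Set G) :=
      Subgroup.isOpen_of_mem_nhds _ (Filter.mem_of_superset hS Subgroup.subset_closure)
    exact SetLike.coe_injective
      (IsClopen.eq_univ ⟨Subgroup.isClosed_of_isOpen _ hopen, hopen⟩ ⟨1, Subgroup.one_mem _⟩)
  have hdense : Dense (S : Set G) := by
    have := dense_submonoidClosure_iff_subgroupClosure (s := (S : Set G))
    rw [Submonoid.closure_eq, hclosure] at this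
    exact this.2 dense_univ
  refine eq_top_iff.2 fun x _ => ?_
  obtain ⟨y, hy, hyS⟩ := hdense.inter_nhds_nonempty
    (t := (fun y => y⁻¹ * x) ⁻¹' S) (x := x * g⁻¹)
    ((by fun_prop : Continuous fun y : G => y⁻¹ * x).continuousAt.preimage_mem_nhds
      (by simpa using hS))
  rw [← mul_inv_cancel_left y x]
  exact S.mul_mem hy hyS

end TopologicalGroup

section UnitaryGroup

open Topology

open scoped Matrix.Norms.L2Operator

variable {n : Type*} [Fintype n] [DecidableEq n]

theorem exists_exp_mul_I_notMem_of_finite {s : Set ℂ} (hs : s.Finite) :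
    ∃ θ : ℝ, Complex.exp (θ * Complex.I) ∉ s := by
  by_contra! h
  refine Set.infinite_of_injOn_mapsTo (f := fun θ : ℝ => Complex.exp (θ * Complex.I)) ?_
    (fun θ _ => h θ) (Set.Icc_infinite Real.pi_pos) hs
  intro a ha b hb hab
  refine Real.injOn_cos ha hb ?_
  simpa only [Complex.exp_ofReal_mul_I_re] using congrArg Complex.re hab

theorem joined_one_of_finite_spectrum {A : Type*} [CStarAlgebra A] {u : unitary A}
    (hu : (spectrum ℂ (u : A)).Finite) : Joined 1 u := by
  obtain ⟨θ, hθ⟩ := exists_exp_mul_I_notMem_of_finite hu.neg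
  let c : selfAdjoint A := θ • 1
  have hc : (selfAdjoint.expUnitary c : A) = algebraMap ℂ A (Complex.exp (θ * Complex.I)) := by
    have hcoe : Complex.I • (c : A) = algebraMap ℂ A (θ * Complex.I) := by
      simp [c, Algebra.algebraMap_eq_smul_one, mul_comm, mul_smul]
    rw [selfAdjoint.expUnitary_coe, hcoe, Complex.exp_eq_exp_ℂ, NormedSpace.algebraMap_exp_comm]
  -- Unitaries at distance less than `2` are joined; the phase `θ` keeps `u` within that distance
  -- of the scalar `exp (i c)`.
  refine (selfAdjoint.joined_one_expUnitary c).trans (Unitary.joined u _ ?_).symm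
  rw [Unitary.norm_sub_eq, Unitary.norm_sub_one_lt_two_iff (Subtype.prop _), spectrum.notMem_iff]
  rw [Set.mem_neg, spectrum.notMem_iff, map_neg, ← hc] at hθ
  convert hθ.mul (Unitary.toUnits (star u)).isUnit using 1
  simp [add_mul, sub_eq_add_neg, add_comm]

/-- The matrix `diag(1, …, conj (det g), …, 1)` whose only nontrivial entry, at `o`, makes the
product with a unitary matrix `g` unimodular; `g ↦ detCorrection o g * g` is then a retraction of
the unitary group onto the special unitary group. -/
noncomputable def detCorrection (o : n) (g : Matrix n n ℂ) : Matrix n n ℂ :=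
  diagonal (Function.update 1 o (star g.det))

theorem detCorrection_mem_unitaryGroup (o : n) {g : Matrix n n ℂ} (hg : g ∈ unitaryGroup n ℂ) :
    detCorrection o g ∈ unitaryGroup n ℂ := by
  have hdet : g.det * star g.det = 1 := Unitary.mul_star_self_of_mem (det_of_mem_unitary hg)
  rw [detCorrection, mem_unitaryGroup_iff', star_eq_conjTranspose, diagonal_conjTranspose,
    diagonal_mul_diagonal, ← diagonal_one]
  congr 1
  ext i
  rcases eq_or_ne i o with rfl | hi
  · simpa using hdet
  · simp [Function.update_of_ne hi]

theorem det_detCorrection (o : n) (g : Matrix n n ℂ) : (detCorrection o g).det = star g.det := by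
  rw [detCorrection, det_diagonal, Finset.prod_update_of_mem (Finset.mem_univ o)]
  simp

theorem detCorrection_mul_mem_specialUnitaryGroup (o : n) {g : Matrix n n ℂ}
    (hg : g ∈ unitaryGroup n ℂ) : detCorrection o g * g ∈ specialUnitaryGroup n ℂ := by
  rw [mem_specialUnitaryGroup_iff, det_mul, det_detCorrection]
  exact ⟨mul_mem (detCorrection_mem_unitaryGroup o hg) hg,
    Unitary.star_mul_self_of_mem (det_of_mem_unitary hg)⟩

theorem detCorrection_of_det_eq_one (o : n) {g : Matrix n n ℂ} (hg : g.det = 1) :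
    detCorrection o g = 1 := by
  have hupdate : Function.update (1 : n → ℂ) o 1 = 1 := Function.update_eq_self o (1 : n → ℂ)
  rw [detCorrection, hg, star_one, hupdate]
  exact diagonal_one

theorem continuous_detCorrection (o : n) : Continuous (detCorrection (n := n) o) := by
  unfold detCorrection
  fun_prop

instance : IsTopologicalGroup (specialUnitaryGroup n ℂ) where
  continuous_inv := continuous_subtype_val.star.subtype_mk _

instance : CompactSpace (specialUnitaryGroup n ℂ) := by
  have hclosed : IsClosed (specialUnitaryGroup n ℂ : Set (Matrix n n ℂ)) :=
    isClosed_unitary.inter (isClosed_eq continuous_id.matrix_det continuous_const)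
  have hbounded : Bornology.IsBounded (specialUnitaryGroup n ℂ : Set (Matrix n n ℂ)) :=
    (Metric.isBounded_closedBall (x := 0) (r := 1)).subset fun M hM => by
      rw [mem_closedBall_zero_iff]
      nontriviality Matrix n n ℂ
      exact (CStarRing.norm_of_mem_unitary hM.1).le
  have : ProperSpace (Matrix n n ℂ) := FiniteDimensional.proper ℂ _
  exact isCompact_iff_compactSpace.1 (Metric.isCompact_of_isClosed_isBounded hclosed hbounded)

instance : PreconnectedSpace (unitaryGroup n ℂ) := by
  suffices h : ∀ u : unitaryGroup n ℂ, Joined 1 u by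
    have : PathConnectedSpace (unitaryGroup n ℂ) := ⟨⟨1⟩, fun u v => (h u).symm.trans (h v)⟩
    infer_instance
  exact fun u => joined_one_of_finite_spectrum (finite_spectrum _)

instance : PreconnectedSpace (specialUnitaryGroup n ℂ) := by
  rcases isEmpty_or_nonempty n with hn | ⟨⟨o⟩⟩
  · infer_instance
  let f : unitaryGroup n ℂ → specialUnitaryGroup n ℂ := fun g =>
    ⟨detCorrection o g * g, detCorrection_mul_mem_specialUnitaryGroup o g.2⟩
  have hf : Continuous f :=
    (((continuous_detCorrection o).comp continuous_subtype_val).mul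
      continuous_subtype_val).subtype_mk _
  have hsurj : Function.Surjective f := fun ⟨g, hg⟩ => by
    rw [mem_specialUnitaryGroup_iff] at hg
    exact ⟨⟨g, hg.1⟩, Subtype.ext (by simp [f, detCorrection_of_det_eq_one o hg.2])⟩
  exact ⟨hsurj.range_eq ▸ isPreconnected_range hf⟩

theorem det_exp_of_conjTranspose_eq_neg {X : Matrix n n ℂ} (hX : Xᴴ = -X) :
    (NormedSpace.exp X).det = Complex.exp X.trace := by
  have hH : (Complex.I • X).IsHermitian := by
    rw [IsHermitian, conjTranspose_smul, hX]
    simp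
  obtain ⟨U, D, hUD⟩ : ∃ (U : (Matrix n n ℂ)ˣ) (D : n → ℂ),
      Complex.I • X = (U : Matrix n n ℂ) * diagonal D * (U⁻¹ : (Matrix n n ℂ)ˣ) :=
    ⟨Unitary.toUnits hH.eigenvectorUnitary, _, hH.spectral_theorem⟩
  have hX : X = (U : Matrix n n ℂ) * diagonal (-Complex.I • D) * (U⁻¹ : (Matrix n n ℂ)ˣ) := by
    rw [diagonal_smul, mul_smul_comm, smul_mul_assoc, ← hUD, smul_smul]
    simp
  rw [hX, Matrix.exp_units_conj, det_units_conj, Matrix.exp_diagonal, det_diagonal,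
    trace_units_conj, trace_diagonal, Complex.exp_sum]
  refine Finset.prod_congr rfl fun i _ => ?_
  rw [Pi.coe_exp, Complex.exp_eq_exp_ℂ]

theorem exp_mem_specialUnitaryGroup {X : Matrix n n ℂ} (hX : X ∈ su n) :
    NormedSpace.exp X ∈ specialUnitaryGroup n ℂ := by
  rw [mem_specialUnitaryGroup_iff]
  have : NormedAlgebra ℚ (Matrix n n ℂ) := .restrictScalars ℚ ℂ _
  exact ⟨NormedSpace.exp_mem_unitary_of_mem_skewAdjoint hX.1, by
    rw [det_exp_of_conjTranspose_eq_neg hX.1, hX.2, Complex.exp_zero]⟩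

theorem conj_mem_su {g : (Matrix n n ℂ)ˣ} (hg : (g : Matrix n n ℂ) ∈ unitaryGroup n ℂ)
    {X : Matrix n n ℂ} (hX : X ∈ su n) :
    (g * X * (g⁻¹ : (Matrix n n ℂ)ˣ) : Matrix n n ℂ) ∈ su n := by
  have hinv : ((g⁻¹ : (Matrix n n ℂ)ˣ) : Matrix n n ℂ) = (g : Matrix n n ℂ)ᴴ :=
    Units.inv_eq_of_mul_eq_one_right (mem_unitaryGroup_iff.1 hg)
  refine ⟨?_, by rw [trace_units_conj, hX.2]⟩
  rw [hinv, conjTranspose_mul, conjTranspose_mul, conjTranspose_conjTranspose, hX.1]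
  simp [mul_assoc]

theorem eventually_mem_su_of_exp_mem :
    ∀ᶠ X in 𝓝 (0 : Matrix n n ℂ), NormedSpace.exp X ∈ specialUnitaryGroup n ℂ → X ∈ su n := by
  have hinj : ∀ᶠ X in 𝓝 (0 : Matrix n n ℂ), NormedSpace.exp Xᴴ = NormedSpace.exp (-X) →
      Xᴴ = -X := by
    have h : Continuous fun X : Matrix n n ℂ => (Xᴴ, -X) := by fun_prop
    filter_upwards [(h.tendsto' 0 0 (by simp)).eventually eventually_exp_eq_iff] with X hX
    exact hX.1
  have htrace : ∀ᶠ X in 𝓝 (0 : Matrix n n ℂ), |X.trace.im| < Real.pi := by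
    have h : Continuous fun X : Matrix n n ℂ => |X.trace.im| := by fun_prop
    exact (h.tendsto' 0 0 (by simp)).eventually_lt_const Real.pi_pos
  filter_upwards [hinj, htrace] with X hinj htrace hexp
  rw [mem_specialUnitaryGroup_iff, mem_unitaryGroup_iff'] at hexp
  have hskew : Xᴴ = -X := hinj <| by
    rw [Matrix.exp_conjTranspose, Matrix.exp_neg]
    exact (inv_eq_left_inv hexp.1).symm
  rw [abs_lt] at htrace
  refine ⟨hskew, Complex.exp_inj_of_neg_pi_lt_of_le_pi htrace.1 htrace.2.le
    (by simpa using Real.pi_pos) (by simpa using Real.pi_pos.le) ?_⟩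
  rw [← det_exp_of_conjTranspose_eq_neg hskew, hexp.2, Complex.exp_zero]

theorem eq_top_of_su_le_lieSpan {S : Submonoid (specialUnitaryGroup n ℂ)}
    {D : Set (Matrix n n ℂ)} (hD : su n ≤ LieSubalgebra.lieSpan ℝ _ D)
    (hS : ∀ C ∈ D, ∀ t : ℝ, 0 ≤ t →
      NormedSpace.exp (t • C) ∈ S.map (specialUnitaryGroup n ℂ).subtype) : S = ⊤ := by
  obtain ⟨g, R, hgR, hR⟩ := exists_isTangentSpaceAt_conj_mem hS
  obtain ⟨k, -, hkg⟩ := hgR.mem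
  obtain ⟨V, _, _, _, F, F', hF, hF_zero, hFS, rfl⟩ := hgR
  have hg : (g : Matrix n n ℂ) ∈ specialUnitaryGroup n ℂ := hkg ▸ k.2
  have hginv : ((g⁻¹ : (Matrix n n ℂ)ˣ) : Matrix n n ℂ) ∈ specialUnitaryGroup n ℂ := by
    rw [Units.inv_eq_of_mul_eq_one_right (mem_unitaryGroup_iff.1 hg.1)]
    exact (star (⟨g, hg⟩ : specialUnitaryGroup n ℂ)).2
  have hsu : (su n).toSubmodule ≤ F'.range := fun X hX => by
    have hmem := hR _ (lieSpan_le_conjSpan hS (hD (conj_mem_su (g := g⁻¹) hginv.1 hX)))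
    simpa [mul_assoc] using hmem
  have hFSU : ∀ᶠ v in 𝓝 0, F v ∈ specialUnitaryGroup n ℂ := by
    filter_upwards [hFS] with v ⟨s, _, hs⟩
    rw [← Units.mul_inv_cancel_right (F v) g, ← hs]
    exact mul_mem s.2 hginv
  have hS_near_one : ∀ᶠ Z : Matrix n n ℂ in 𝓝[specialUnitaryGroup n ℂ] 1,
      Z * (g : Matrix n n ℂ) ∈ S.map (specialUnitaryGroup n ℂ).subtype :=
    nhdsWithin_one_le_map eventually_mem_su_of_exp_mem hF hF_zero hFSU hsu hFS
  have htranslate : Filter.Tendsto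
      (fun x : specialUnitaryGroup n ℂ => ((x * k⁻¹ : specialUnitaryGroup n ℂ) : Matrix n n ℂ))
      (𝓝 k) (𝓝[specialUnitaryGroup n ℂ] 1) :=
    tendsto_nhdsWithin_iff.2 ⟨(by fun_prop : Continuous _).tendsto' _ _ (by simp),
      .of_forall fun x => (x * k⁻¹).2⟩
  refine submonoid_eq_top_of_mem_nhds (g := k) ?_
  filter_upwards [htranslate.eventually hS_near_one] with x ⟨s, hs, hsx⟩
  have hxs : x = s := Subtype.ext <| by
    rw [← hkg] at hsx
    exact (congrArg Subtype.val (inv_mul_cancel_right x k)).symm.trans hsx.symm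
  exact hxs ▸ hs

end UnitaryGroup

section ControlSystem

open Topology
open scoped Matrix.Norms.L2Operator

/-- The control that follows `u` up to the time `S` and then `v`, restarted at `S`. -/
noncomputable def concatControl (u v : ℝ → ℝ) (S t : ℝ) : ℝ :=
  if t < S then u t else v (t - S)

variable {u v : ℝ → ℝ} {S T t : ℝ}

theorem concatControl_eventuallyEq_left (u v : ℝ → ℝ) (ht : t < S) :
    concatControl u v S =ᶠ[𝓝 t] u := by
  filter_upwards [eventually_lt_nhds ht] with s hs using if_pos hs

theorem concatControl_eventuallyEq_right (u v : ℝ → ℝ) (ht : S < t) :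
    concatControl u v S =ᶠ[𝓝 t] fun s => v (s - S) := by
  filter_upwards [eventually_gt_nhds ht] with s hs using if_neg hs.not_gt

theorem PiecewiseConstant.concat (hu : PiecewiseConstant u S) (hv : PiecewiseConstant v T) :
    PiecewiseConstant (concatControl u v S) (S + T) := by
  obtain ⟨P, hP⟩ := hu
  obtain ⟨Q, hQ⟩ := hv
  refine ⟨insert S (P ∪ Q.image (· + S)), fun t ht htPQ => ?_⟩
  simp only [Finset.mem_insert, Finset.mem_union, Finset.mem_image, not_or, not_exists,
    not_and] at htPQ
  obtain ⟨htS, htP, htQ⟩ := htPQ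
  rcases lt_or_gt_of_ne htS with htS | htS
  · have hloc := concatControl_eventuallyEq_left u v htS
    filter_upwards [hloc, hP t ⟨ht.1, htS⟩ htP] with s hs hu
    rw [hs, hu, hloc.self_of_nhds]
  · have hloc := concatControl_eventuallyEq_right u v htS
    have hv := hQ (t - S) ⟨sub_pos.2 htS, sub_left_lt_of_lt_add ht.2⟩
      fun h => htQ _ h (sub_add_cancel t S)
    filter_upwards [hloc, (continuous_sub_right S).continuousAt.eventually hv] with s hs hv
    rw [hs, hv, hloc.self_of_nhds]

variable {N : ℕ} {A B : Matrix (Fin N) (Fin N) ℂ} {X Y : ℝ → specialUnitaryGroup (Fin N) ℂ}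

theorem IsIntegralCurve.concat (hS : 0 ≤ S) (hT : 0 ≤ T) (hX : IsIntegralCurve A B u S X)
    (hY : IsIntegralCurve A B v T Y) :
    IsIntegralCurve A B (concatControl u v S) (S + T)
      (fun t => Y (max (t - S) 0) * X (min t S)) := by
  obtain ⟨hX_zero, hX_cont, P, hP⟩ := hX
  obtain ⟨hY_zero, hY_cont, Q, hQ⟩ := hY
  refine ⟨?_, ?_, insert S (P ∪ Q.image (· + S)), fun t ht htPQ => ?_⟩
  · simp [hS, hX_zero, hY_zero]
  · refine (hY_cont.comp (by fun_prop) fun t ht => ?_).mul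
      (hX_cont.comp (by fun_prop) fun t ht => ?_)
    · exact ⟨le_max_right _ _, max_le (sub_left_le_of_le_add ht.2) hT⟩
    · exact ⟨le_min ht.1 hS, min_le_right _ _⟩
  simp only [Finset.mem_insert, Finset.mem_union, Finset.mem_image, not_or, not_exists,
    not_and] at htPQ
  obtain ⟨htS, htP, htQ⟩ := htPQ
  rcases lt_or_gt_of_ne htS with htS | htS
  · have hcurve : (fun s => Y (max (s - S) 0) * X (min s S)) =ᶠ[𝓝 t] X := by
      filter_upwards [eventually_lt_nhds htS] with s hs
      rw [max_eq_right (sub_nonpos.2 hs.le), min_eq_left hs.le, hY_zero, one_mul]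
    rw [(concatControl_eventuallyEq_left u v htS).self_of_nhds, hcurve.self_of_nhds]
    exact (hP t ⟨ht.1, htS⟩ htP).congr_of_eventuallyEq (hcurve.fun_comp Subtype.val)
  · have hcurve : (fun s => Y (max (s - S) 0) * X (min s S)) =ᶠ[𝓝 t]
        fun s => Y (s - S) * X S := by
      filter_upwards [eventually_gt_nhds htS] with s hs
      rw [max_eq_left (sub_nonneg.2 hs.le), min_eq_right hs.le]
    have hderiv := hQ (t - S) ⟨sub_pos.2 htS, sub_left_lt_of_lt_add ht.2⟩
      fun h => htQ _ h (sub_add_cancel t S)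
    rw [(concatControl_eventuallyEq_right u v htS).self_of_nhds, hcurve.self_of_nhds,
      Submonoid.coe_mul, ← mul_assoc]
    exact ((hderiv.comp_sub_const t S).mul_const _).congr_of_eventuallyEq
      (hcurve.fun_comp Subtype.val)

variable (A B) in
/-- The reachable set as a submonoid: steering to `Z` and then along a trajectory that ends at
`Z'` reaches `Z' * Z`, since the system is right-invariant. -/
def reachableSubmonoid : Submonoid (specialUnitaryGroup (Fin N) ℂ) where
  carrier := reachableSet A B
  one_mem' := ⟨0, le_rfl, fun _ => 0, ⟨∅, by simp⟩, fun _ => 1,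
    ⟨rfl, continuousOn_const, ∅, by simp⟩, rfl⟩
  mul_mem' := by
    rintro _ _ ⟨T, hT, v, hv, Y, hY, rfl⟩ ⟨S, hS, u, hu, X, hX, rfl⟩
    exact ⟨S + T, add_nonneg hS hT, concatControl u v S, hu.concat hv, _, hX.concat hS hT hY,
      by simp [hT]⟩

theorem exp_mem_reachableSubmonoid (hA : A ∈ su (Fin N)) (hB : B ∈ su (Fin N)) (c : ℝ)
    (hT : 0 ≤ T) :
    NormedSpace.exp (T • (A + c • B)) ∈
      (reachableSubmonoid A B).map (specialUnitaryGroup (Fin N) ℂ).subtype := by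
  have hmem : ∀ t : ℝ, t • (A + c • B) ∈ su (Fin N) := fun t =>
    (su (Fin N)).smul_mem t (add_mem hA ((su (Fin N)).smul_mem c hB))
  let X : ℝ → specialUnitaryGroup (Fin N) ℂ := fun t =>
    ⟨NormedSpace.exp (t • (A + c • B)), exp_mem_specialUnitaryGroup (hmem t)⟩
  have hX : ∀ t, HasDerivAt (fun s => (X s : Matrix (Fin N) (Fin N) ℂ)) ((A + c • B) * X t) t :=
    hasDerivAt_exp_smul_const' (A + c • B)
  have hX_cont : Continuous X :=
    (continuous_iff_continuousAt.2 fun t => (hX t).continuousAt).subtype_mk _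
  exact ⟨X T, ⟨T, hT, fun _ => c, ⟨∅, by simp⟩, X,
    ⟨Subtype.ext (by simp [X]), hX_cont.continuousOn, ∅, fun t _ _ => hX t⟩, rfl⟩, rfl⟩

theorem controllable_of_su_le_lieSpan (hA : A ∈ su (Fin N)) (hB : B ∈ su (Fin N))
    (h : su (Fin N) ≤ LieSubalgebra.lieSpan ℝ _ {A, B}) : Controllable A B := by
  let D := Set.range fun c : ℝ => A + c • B
  have hAD : A ∈ LieSubalgebra.lieSpan ℝ _ D := LieSubalgebra.subset_lieSpan ⟨0, by simp⟩
  have hABD : A + B ∈ LieSubalgebra.lieSpan ℝ _ D := LieSubalgebra.subset_lieSpan ⟨1, by simp⟩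
  have hD : su (Fin N) ≤ LieSubalgebra.lieSpan ℝ _ D := by
    refine h.trans (LieSubalgebra.lieSpan_le.2 ?_)
    rintro _ (rfl | rfl)
    · exact hAD
    · simpa using sub_mem hABD hAD
  have htop : reachableSubmonoid A B = ⊤ := eq_top_of_su_le_lieSpan hD <| by
    rintro _ ⟨c, rfl⟩ t ht
    exact exp_mem_reachableSubmonoid hA hB c ht
  exact congrArg SetLike.coe htop

end ControlSystem

section Drift

open Polynomial

variable {N : ℕ} {E : Fin N → ℝ} {L : LieSubalgebra ℝ (Matrix (Fin N) (Fin N) ℂ)}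
  {B M : Matrix (Fin N) (Fin N) ℂ}

theorem drift_mem_su (hE : ∑ i, E i = 0) : drift E ∈ su (Fin N) := by
  rw [mem_su, drift]
  refine ⟨?_, ?_⟩
  · rw [conjTranspose_smul, diagonal_conjTranspose, ← neg_smul]
    congr 2
    · simp
    · ext i
      simp
  · rw [trace_smul, trace_diagonal, ← Complex.ofReal_sum, hE, Complex.ofReal_zero, smul_zero]

theorem rootValue_swap (i j : Fin N) : rootValue E (j, i) = -rootValue E (i, j) :=
  (neg_sub _ _).symm

theorem lie_drift_apply (M : Matrix (Fin N) (Fin N) ℂ) (k l : Fin N) :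
    ⁅drift E, M⁆ k l = Complex.I * rootValue E (k, l) * M k l := by
  rw [Ring.lie_def, Matrix.sub_apply, drift, smul_mul_assoc, mul_smul_comm, Matrix.smul_apply,
    Matrix.smul_apply, diagonal_mul, mul_diagonal, rootValue]
  push_cast
  simp only [smul_eq_mul]
  ring

theorem lie_drift_skewSingle (i j : Fin N) (z : ℂ) :
    ⁅drift E, skewSingle i j z⁆ = skewSingle i j (Complex.I * rootValue E (i, j) * z) := by
  ext k l
  rw [lie_drift_apply, skewSingle_apply, skewSingle_apply]
  simp only [Matrix.sub_apply, single_apply, mul_sub, mul_ite, mul_zero]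
  congr 1
  · split_ifs with h
    · rw [h.1, h.2]
    · rfl
  · split_ifs with h
    · rw [← h.1, ← h.2, rootValue_swap]
      simp
    · rfl

theorem of_eval_rootValue_sq_smul_mem (hA : drift E ∈ L) (hM : M ∈ L) (p : ℝ[X]) :
    (of fun k l => p.eval (rootValue E (k, l) ^ 2) • M k l) ∈ L := by
  induction p using Polynomial.induction_on with
  | C a =>
    convert L.smul_mem a hM using 1
    ext k l
    simp
  | add p q hp hq =>
    convert L.add_mem hp hq using 1
    ext k l
    simp [add_smul]
  | monomial m a hm =>
    convert L.smul_mem (-1 : ℝ) (L.lie_mem hA (L.lie_mem hA hm)) using 1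
    ext k l
    simp only [Matrix.smul_apply, lie_drift_apply, of_apply, eval_mul, eval_C, eval_pow, eval_X,
      Complex.real_smul]
    push_cast
    linear_combination
      (a * (rootValue E (k, l) ^ 2) ^ (m + 1) * M k l : ℂ) * Complex.I_sq

theorem of_rootValue_sq_smul_mem (hA : drift E ∈ L) (hM : M ∈ L) (φ : ℝ → ℝ) :
    (of fun k l => φ (rootValue E (k, l) ^ 2) • M k l) ∈ L := by
  let values := Finset.univ.image fun q : Fin N × Fin N => rootValue E q ^ 2
  convert of_eval_rootValue_sq_smul_mem hA hM (Lagrange.interpolate values id φ) using 6 with k l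
  have hmem : rootValue E (k, l) ^ 2 ∈ values := Finset.mem_image_of_mem _ (Finset.mem_univ (k, l))
  exact (Lagrange.eval_interpolate_at_node φ Function.injective_id.injOn hmem).symm

theorem IsRegularRoot.eq_or_eq_swap {i j k l : Fin N} (h : IsRegularRoot E (i, j))
    (hsq : rootValue E (k, l) ^ 2 = rootValue E (i, j) ^ 2) :
    (k, l) = (i, j) ∨ (k, l) = (j, i) := by
  have hkl : k ≠ l := by
    rintro rfl
    exact h.1 (by simpa [rootValue] using hsq.symm)
  by_contra! hne
  rcases sq_eq_sq_iff_eq_or_eq_neg.1 hsq with heq | heq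
  · exact h.2 (k, l) hkl hne.1 heq
  · exact h.2 (l, k) hkl.symm (by grind) (by rw [rootValue_swap, heq, neg_neg])

theorem skewSingle_mem_of_isRegularRoot (hA : drift E ∈ L) (hBL : B ∈ L) (hB : Bᴴ = -B)
    {i j : Fin N} (hij : i ≠ j) (hreg : IsRegularRoot E (i, j)) :
    skewSingle i j (B i j) ∈ L := by
  have hji : -star (B i j) = B j i := by
    rw [← conjTranspose_apply, hB, Matrix.neg_apply, neg_neg]
  convert of_rootValue_sq_smul_mem hA hBL
    (fun x => if x = rootValue E (i, j) ^ 2 then 1 else 0) using 1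
  ext k l
  simp only [skewSingle_apply, Matrix.sub_apply, single_apply, of_apply]
  by_cases hkl : (k, l) = (i, j)
  · obtain ⟨rfl, rfl⟩ := Prod.mk.inj hkl
    simp [hij, hij.symm]
  by_cases hlk : (k, l) = (j, i)
  · obtain ⟨rfl, rfl⟩ := Prod.mk.inj hlk
    simp [hij, hij.symm, rootValue_swap l k, ← hji]
  · have hval : rootValue E (k, l) ^ 2 ≠ rootValue E (i, j) ^ 2 := fun hsq =>
      (hreg.eq_or_eq_swap hsq).elim hkl hlk
    rw [Prod.mk.injEq] at hkl hlk
    rw [if_neg (by tauto), if_neg (by tauto), if_neg hval, zero_smul, sub_zero]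

theorem skewSingle_mem_of_ne_zero (hA : drift E ∈ L) {i j : Fin N}
    (hv : rootValue E (i, j) ≠ 0) {b : ℂ} (hb : b ≠ 0) (h : skewSingle i j b ∈ L) (z : ℂ) :
    skewSingle i j z ∈ L := by
  have hlie := L.lie_mem hA h
  rw [lie_drift_skewSingle] at hlie
  have hcomb : z = (z / b).re • b +
      ((z / b).im / rootValue E (i, j)) • (Complex.I * rootValue E (i, j) * b) := by
    have hv' : (rootValue E (i, j) : ℂ) ≠ 0 := Complex.ofReal_ne_zero.2 hv
    calc z = ((z / b).re + (z / b).im * Complex.I) * b := by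
          rw [Complex.re_add_im, div_mul_cancel₀ _ hb]
      _ = _ := by
          simp only [Complex.real_smul, Complex.ofReal_div]
          field_simp
  rw [hcomb, map_add, map_smul, map_smul]
  exact L.add_mem (L.smul_mem _ h) (L.smul_mem _ hlie)

theorem exists_mem_regularRoots_of_regularPart_ne_zero {i j : Fin N} (hij : i ≠ j)
    (h : regularPart E B i j ≠ 0) : ∃ p ∈ regularRoots E B, p = (i, j) ∨ p = (j, i) := by
  rw [regularPart, Matrix.add_apply, diagonal_apply_ne _ hij, zero_add, Matrix.sum_apply] at h
  obtain ⟨p, hp, hne⟩ := Finset.exists_ne_zero_of_sum_ne_zero h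
  refine ⟨p, hp, ?_⟩
  contrapose! hne
  have hp : ¬(p.1 = i ∧ p.2 = j) := fun hp => hne.1 (Prod.ext hp.1 hp.2)
  have hp' : ¬(p.2 = i ∧ p.1 = j) := fun hp => hne.2 (Prod.ext hp.2 hp.1)
  simp [rootComponent, basisX, basisY, hp, hp']

theorem skewSingle_mem_of_adj (hA : drift E ∈ L) (hBL : B ∈ L) (hB : Bᴴ = -B) {i j : Fin N}
    (h : (matrixGraph (regularPart E B)).toSimpleGraphInclusive.Adj i j) (z : ℂ) :
    skewSingle i j z ∈ L := by
  have hmem : ∀ p ∈ regularRoots E B, ∀ w, skewSingle p.1 p.2 w ∈ L := by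
    intro p hp
    simp only [regularRoots, positiveRoots, Finset.mem_filter, Finset.mem_univ, true_and] at hp
    obtain ⟨⟨hlt, hb⟩, hreg⟩ := hp
    exact skewSingle_mem_of_ne_zero hA hreg.1 hb
      (skewSingle_mem_of_isRegularRoot hA hBL hB hlt.ne hreg)
  obtain ⟨hij, h⟩ := h
  obtain ⟨p, hp, rfl | rfl⟩ : ∃ p ∈ regularRoots E B, p = (i, j) ∨ p = (j, i) := by
    rcases h with h | h
    · exact exists_mem_regularRoots_of_regularPart_ne_zero hij h
    · simpa only [or_comm] using exists_mem_regularRoots_of_regularPart_ne_zero hij.symm h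
  · exact hmem _ hp z
  · rw [skewSingle_swap]
    exact hmem _ hp _

theorem su_le_lieSpan_drift (hB : Bᴴ = -B) (hG : GraphConnected (regularPart E B)) :
    su (Fin N) ≤ LieSubalgebra.lieSpan ℝ _ {drift E, B} :=
  su_le_of_skewSingle_mem fun _ _ hij =>
    skewSingle_mem_of_preconnected hG.preconnected
      (fun _ _ => skewSingle_mem_of_adj (LieSubalgebra.subset_lieSpan (by simp))
        (LieSubalgebra.subset_lieSpan (by simp)) hB) hij

end Drift

end QuantumControl

theorem mainTheorem4_general (N : ℕ) (E : Fin N → ℝ) (hE_trace : ∑ i, E i = 0)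
    (B : Matrix (Fin N) (Fin N) ℂ) (hB : B.conjTranspose = -B) (hB_trace : B.trace = 0)
    (hGr : QuantumControl.GraphConnected (QuantumControl.regularPart E B)) :
    QuantumControl.Controllable (QuantumControl.drift E) B :=
  QuantumControl.controllable_of_su_le_lieSpan (QuantumControl.drift_mem_su hE_trace)
    ⟨hB, hB_trace⟩ (QuantumControl.su_le_lieSpan_drift hB hGr)

theorem mainTheorem4 (N : ℕ) (E : Fin N → ℝ) (hE : Monotone E) (hE_trace : ∑ i, E i = 0)
    (B : Matrix (Fin N) (Fin N) ℂ) (hB : B.conjTranspose = -B) (hB_trace : B.trace = 0)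
    (hG : QuantumControl.GraphConnected B)
    (hGr : QuantumControl.GraphConnected (QuantumControl.regularPart E B)) :
    QuantumControl.Controllable (QuantumControl.drift E) B :=
  mainTheorem4_general N E hE_trace B hB hB_trace hGr
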